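/- Let $K\ge 0$ and $N,J\ge 1$ be integers, and let $\mathbf S^{K+2}$ be the space of real symmetric $(K+2)\times(K+2)$ matrices, with $\mathbf S_+^{K+2}$ its cone of positive semidefinite matrices. Equip $\mathbf S^{K+2}\times\mathbf R^{K+1}$ with the inner product $\langle (X,Y),(G,F)\rangle=\operatorname{tr}(X^TG)+Y^TF$, with an arbitrary norm $\|\cdot\|$, and with its dual norm $\|V\|_*=\sup\{\langle V,Z\rangle : \|Z\|\le 1\}$. Let $M$ be a finite index set, let $(A_m,b_m)$ for $m\in M$ and $(A_0,b_0)$ be elements of $\mathbf S^{K+2}\times\mathbf R^{K+1}$, and let $c_0\in\mathbf R$. Put $\mathcal S(G,F)=(-\langle (A_m,b_m),(G,F)\rangle)_{m\in M}$, $\mathcal S^*(y)=-\sum_{m\in M}y_m(A_m,b_m)$, $$\mathcal F=\{(G,F)\in\mathbf S_+^{K+2}\times\mathbf R^{K+1} : \mathcal S(G,F)\in\mathbf R_+^{M}\},\qquad \mathcal X=\{(G,F)\in\mathbf S_+^{K+2}\times\mathbf R^{K+1} : \langle (A_0,b_0),(G,F)\rangle+c_0\le 0\},$$ and assume that $\mathcal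 F\cap\mathcal X$ is compact. Let $\widehat Z_1,\dots,\widehat Z_N\in\mathcal F\cap\mathcal X$ and let $\varepsilon>0$. Let $\mathcal P_\varepsilon$ be the set of Borel probability measures $\mathbf Q$ on $\mathcal F\cap\mathcal X$ with $W(\frac1N\sum_{i=1}^N\delta_{\widehat Z_i},\mathbf Q)\le\varepsilon$, where $W(\mathbf P,\mathbf Q)=\inf_\pi\int\|Z_1-Z_2\|\,d\pi(Z_1,Z_2)$, the infimum being over all couplings $\pi$ of $\mathbf P$ and $\mathbf Q$, is the type-1 Wasserstein distance. For $j=1,\dots,J$ let $(A^j,b^j)\in\mathbf S^{K+2}\times\mathbf R^{K+1}$ and $c^j\in\mathbf R$, and let $\mathcal L$ be the set of all functions $\ell:\mathcal F\cap\mathcal X\to\mathbf R$ of the form $$\ell(Z)=\max_{1\le j\le J}\big(\langle (A^j,b^j),Z\rangle+c^jt\big),\qquad t\in\mathbf R .$$ Then the following three values in $[-\infty,\infty]$ are equal (the supremum over an empty set being $-\infty$ and the infimum over an empty set $+\infty$): 1. the worst-case expectation $\displaystyle\sup_{\mathbf Q\in\mathcal P_\varepsilon}\ \inf_{\ell\in\mathcal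 L}\ \mathbf E_{Z\sim\mathbf Q}\,\ell(Z)$; 2. the optimal value of the maximization problem $$\sup\ \sum_{i=1}^N\sum_{j=1}^J\alpha_i^j\langle (A^j,b^j),Z_i^j\rangle\quad\text{subject to}\quad\sum_{i=1}^N\sum_{j=1}^J\alpha_i^j\|Z_i^j-\widehat Z_i\|\le\varepsilon,$$ over points $Z_i^j=(G_i^j,F_i^j)\in\mathcal F\cap\mathcal X$ and weights $\alpha_i^j\ge0$ with $\sum_{j}\alpha_i^j=1/N$ for every $i$ and $\sum_{j}\big(\sum_i\alpha_i^j\big)c^j=0$; 3. the optimal value of the convex conic program (DRO-PEP) $$\begin{array}{ll}\inf & \frac1N\sum_{i=1}^N s_i\\ \text{subject to} & c^jt-c_0\tau_i^j-\langle (X_i^j,Y_i^j),\widehat Z_i\rangle+\lambda\varepsilon\le s_i,\\ & -\mathcal S^*(y_i^j)-(X_i^j,Y_i^j)+\tau_i^j(A_0,b_0)-(A^j,b^j)\in\mathbf S_+^{K+2}\times\{0\},\\ & \|(X_i^j,Y_i^j)\|_*\le\lambda,\qquad i=1,\dots,N,\ j=1,\dots,J,\end{array}$$ over $s_i,t\in\mathbf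 R$, $\lambda,\tau_i^j\in\mathbf R_+$, $(X_i^j,Y_i^j)\in\mathbf S^{K+2}\times\mathbf R^{K+1}$ and $y_i^j\in\mathbf R_+^{M}$. -/

import Mathlib

open MeasureTheory
open scoped ENNReal Matrix

noncomputable section

/-- The space of real symmetric `n × n` matrices. -/
def SymMat (n : ℕ) : Submodule ℝ (Matrix (Fin n) (Fin n) ℝ) where
  carrier := {A | A.IsSymm}
  add_mem' := fun hA hB => hA.add hB
  zero_mem' := Matrix.isSymm_zero
  smul_mem' := fun r _ hA => hA.smul r

instance (n : ℕ) : MeasurableSpace (SymMat n) := borel _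

instance (n : ℕ) : BorelSpace (SymMat n) := ⟨rfl⟩

instance (n : ℕ) : SecondCountableTopology (SymMat n) :=
  haveI : SecondCountableTopology (Matrix (Fin n) (Fin n) ℝ) :=
    inferInstanceAs (SecondCountableTopology (Fin n → Fin n → ℝ))
  TopologicalSpace.Subtype.secondCountableTopology (SymMat n : Set (Matrix (Fin n) (Fin n) ℝ))

/-- The lifted space of pairs `Z = (G, F)`: a symmetric matrix of order `K + 2` and a vector of
length `K + 1`. -/
abbrev GramPair (K : ℕ) : Type := SymMat (K + 2) × (Fin (K + 1) → ℝ)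

/-- The inner product `⟨(X, Y), (G, F)⟩ = tr (Xᵀ G) + Yᵀ F`. -/
def pairing {K : ℕ} (V Z : GramPair K) : ℝ :=
  Matrix.trace ((V.1 : Matrix (Fin (K + 2)) (Fin (K + 2)) ℝ)ᵀ *
    (Z.1 : Matrix (Fin (K + 2)) (Fin (K + 2)) ℝ)) + V.2 ⬝ᵥ Z.2

/-- The dual norm of `nrm` with respect to the pairing:
`‖V‖_* = sup {⟨V, Z⟩ | ‖Z‖ ≤ 1}`. -/
def dualNorm {K : ℕ} (nrm : Seminorm ℝ (GramPair K)) (V : GramPair K) : ℝ :=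
  sSup {r : ℝ | ∃ Z : GramPair K, nrm Z ≤ 1 ∧ r = pairing V Z}

/-- The data of the affine description of a function class and of an initial condition:
`interp m = (A_m, b_m)` encodes the interpolation inequality `⟨(A_m, b_m), (G, F)⟩ ≤ 0`, and
`init = (A_0, b_0)`, `c₀` encode the initial condition `⟨(A_0, b_0), (G, F)⟩ + c₀ ≤ 0`. -/
structure PEPData (K : ℕ) (M : Type*) where
  interp : M → GramPair K
  init : GramPair K
  c₀ : ℝ

namespace PEPData

variable {K : ℕ} {M : Type*}

/-- The linear operator `S (G, F) = (-⟨(A_m, b_m), (G, F)⟩)_m`. -/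
def opS (D : PEPData K M) (Z : GramPair K) : M → ℝ :=
  fun m => -pairing (D.interp m) Z

/-- The adjoint operator `S* y = -∑ m, y_m (A_m, b_m)`. -/
def opSAdj [Fintype M] (D : PEPData K M) (y : M → ℝ) : GramPair K :=
  -∑ m, y m • D.interp m

theorem pairing_opSAdj [Fintype M] (D : PEPData K M) (y : M → ℝ) (Z : GramPair K) :
    pairing (D.opSAdj y) Z = ∑ m, y m * D.opS Z m := by
  simp [pairing, PEPData.opSAdj, PEPData.opS, Prod.fst_sum, Prod.snd_sum, Matrix.transpose_sum,
    Finset.sum_mul, Matrix.trace_sum, sum_dotProduct, Matrix.trace_neg, neg_dotProduct, mul_add,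
    Finset.sum_add_distrib]
  ring

/-- The lifted function class `𝓕`. -/
def classF (D : PEPData K M) : Set (GramPair K) :=
  {Z | (Z.1 : Matrix (Fin (K + 2)) (Fin (K + 2)) ℝ).PosSemidef ∧ ∀ m, 0 ≤ D.opS Z m}

/-- The lifted set `𝓧` of initial conditions. -/
def initX (D : PEPData K M) : Set (GramPair K) :=
  {Z | (Z.1 : Matrix (Fin (K + 2)) (Fin (K + 2)) ℝ).PosSemidef ∧
    pairing D.init Z + D.c₀ ≤ 0}

/-- The support set `𝓕 ∩ 𝓧`. -/
def support (D : PEPData K M) : Set (GramPair K) := D.classF ∩ D.initX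

end PEPData

/-- The type-1 Wasserstein distance, for the cost `‖Z₁ - Z₂‖`, between two distributions
supported on `S`: the infimum of the transport cost over all couplings. -/
def wasserstein {K : ℕ} {S : Set (GramPair K)} (nrm : Seminorm ℝ (GramPair K))
    (P Q : Measure S) : ℝ≥0∞ :=
  ⨅ (π : Measure (S × S)) (_ : π.map Prod.fst = P ∧ π.map Prod.snd = Q),
    ∫⁻ z, ENNReal.ofReal (nrm ((z.1 : GramPair K) - (z.2 : GramPair K))) ∂π

/-- The empirical distribution `(1/N) ∑ i, δ_{Ẑ_i}`. -/
def empirical {K N : ℕ} {S : Set (GramPair K)} (Zhat : Fin N → S) : Measure S :=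
  (N : ℝ≥0∞)⁻¹ • ∑ i, Measure.dirac (Zhat i)

/-- The ambiguity set: all probability distributions on `S` within Wasserstein distance `ε`
of the empirical distribution. -/
def ambiguitySet {K N : ℕ} {S : Set (GramPair K)} (nrm : Seminorm ℝ (GramPair K))
    (Zhat : Fin N → S) (ε : ℝ) : Set (Measure S) :=
  {Q | IsProbabilityMeasure Q ∧ wasserstein nrm (empirical Zhat) Q ≤ ENNReal.ofReal ε}

/-- The set of loss functions `ℓ(Z) = max_j (⟨(A_obj^j, b_obj^j), Z⟩ + c_obj^j t)`, `t ∈ ℝ`,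
where `obj j = (A_obj^j, b_obj^j)` and `c j = c_obj^j`. -/
def lossSet {K J : ℕ} [NeZero J] (S : Set (GramPair K)) (obj : Fin J → GramPair K)
    (c : Fin J → ℝ) : Set (S → ℝ) :=
  {ℓ | ∃ t : ℝ, ∀ Z : S, ℓ Z =
    Finset.univ.sup' Finset.univ_nonempty fun j => pairing (obj j) (Z : GramPair K) + c j * t}

/-- The worst-case expected loss `sup_{Q} inf_{ℓ} E_{Z ∼ Q} ℓ(Z)` over the ambiguity set,
as an extended real number. -/
def worstCaseExpectation {K N J : ℕ} [NeZero J] {S : Set (GramPair K)}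
    (nrm : Seminorm ℝ (GramPair K)) (Zhat : Fin N → S) (ε : ℝ)
    (obj : Fin J → GramPair K) (c : Fin J → ℝ) : EReal :=
  ⨆ Q ∈ ambiguitySet nrm Zhat ε, ⨅ ℓ ∈ lossSet S obj c, ((∫ Z, ℓ Z ∂Q : ℝ) : EReal)

/-- The set `Γ` of admissible weights `(α_i^j)`. -/
def weightSet (N : ℕ) {J : ℕ} (c : Fin J → ℝ) : Set (Fin N → Fin J → ℝ) :=
  {α | (∀ i j, 0 ≤ α i j) ∧ (∀ i, ∑ j, α i j = 1 / (N : ℝ)) ∧ ∑ j, (∑ i, α i j) * c j = 0}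

/-- The optimal value, in the extended reals, of the finite-dimensional maximization problem over
`α ∈ Γ` and points `Z_i^j = (G_i^j, F_i^j) ∈ S`. -/
def maximizationValue {K N J : ℕ} {S : Set (GramPair K)}
    (nrm : Seminorm ℝ (GramPair K)) (Zhat : Fin N → S) (ε : ℝ)
    (obj : Fin J → GramPair K) (c : Fin J → ℝ) : EReal :=
  ⨆ (α : Fin N → Fin J → ℝ) (Z : Fin N → Fin J → S)
    (_ : α ∈ weightSet N c ∧
      ∑ i, ∑ j, α i j * nrm ((Z i j : GramPair K) - (Zhat i : GramPair K)) ≤ ε),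
    ((∑ i, ∑ j, α i j * pairing (obj j) (Z i j : GramPair K) : ℝ) : EReal)

/-- The decision variables of the conic minimization problem; `XY i j` is `(X_i^j, Y_i^j)`. -/
structure DROVars (K N J : ℕ) (M : Type*) where
  s : Fin N → ℝ
  t : ℝ
  lam : ℝ
  τ : Fin N → Fin J → ℝ
  y : Fin N → Fin J → M → ℝ
  XY : Fin N → Fin J → GramPair K

/-- Feasibility of the decision variables in the conic minimization problem: the three families of
constraints, after the sign restrictions on `λ`, `τ` and `y`. -/
structure DROVars.Feasible {K N J : ℕ} {M : Type*} [Fintype M] (v : DROVars K N J M)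
    (D : PEPData K M) (nrm : Seminorm ℝ (GramPair K)) (Zhat : Fin N → D.support) (ε : ℝ)
    (obj : Fin J → GramPair K) (c : Fin J → ℝ) : Prop where
  lam_nonneg : 0 ≤ v.lam
  tau_nonneg : ∀ i j, 0 ≤ v.τ i j
  y_nonneg : ∀ i j m, 0 ≤ v.y i j m
  epigraph : ∀ i j,
    c j * v.t - D.c₀ * v.τ i j - pairing (v.XY i j) (Zhat i : GramPair K) + v.lam * ε ≤ v.s i
  conic : ∀ i j,
    let W : GramPair K := -D.opSAdj (v.y i j) - v.XY i j + v.τ i j • D.init - obj j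
    (W.1 : Matrix (Fin (K + 2)) (Fin (K + 2)) ℝ).PosSemidef ∧ W.2 = 0
  dual_norm : ∀ i j, dualNorm nrm (v.XY i j) ≤ v.lam

/-- The optimal value, in the extended reals, of the conic minimization problem. -/
def droPepValue {K N J : ℕ} {M : Type*} [Fintype M] (D : PEPData K M)
    (nrm : Seminorm ℝ (GramPair K)) (Zhat : Fin N → D.support) (ε : ℝ)
    (obj : Fin J → GramPair K) (c : Fin J → ℝ) : EReal :=
  ⨅ (v : DROVars K N J M) (_ : v.Feasible D nrm Zhat ε obj c),
    ((1 / (N : ℝ) * ∑ i, v.s i : ℝ) : EReal)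

end

/-! The three values are compared in a cycle: maximization ≤ worst case ≤ conic program ≤
maximization. A feasible pair (α, Z) gives the discrete distribution with mass α_i^j at Z_i^j.
Moving that mass from Ẑ_i is an admissible coupling, and ∑ α_i^j c^j = 0 cancels t, so the expected
loss is at least the objective (`maximizationValue_le_worstCaseExpectation`). A feasible conic point
certifies ℓ(Z) ≤ λ‖Z - Ẑ_i‖ + s_i - λε on the support for each i. Integrating against a nearly
optimal coupling bounds the expectation by the mean of the s_i (`integral_le_of_mem_ambiguitySet`).
The last inequality is strong duality without a Slater condition (`dro_alternative`). The right-hand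
sides for which the conic program is feasible form a convex cone, possibly not closed. If the data
at level r lie outside it, a nonzero functional (Z, α, μ) weakly separates them, and its sign on the
cone gives the homogenized constraints of the maximization problem. Compactness makes the recession
cone of the support trivial, so μ = 0 would force α = 0, then Z = 0, and the functional would
vanish. Hence μ > 0, and rescaling gives a feasible point of value at least r. -/

/-! ### Weak separation and definite seminorms in finite dimension. -/

/-- In finite dimension, a point outside a convex set containing the origin (closed or not) is
weakly separated from it by a nonzero linear functional. -/
theorem Convex.exists_dual_ne_zero_le_of_notMem {E : Type*} [AddCommGroup E] [Module ℝ E]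
    [FiniteDimensional ℝ E] {C : Set E} (hC : Convex ℝ C) (h0 : (0 : E) ∈ C) {x : E}
    (hx : x ∉ C) : ∃ f : E →ₗ[ℝ] ℝ, f ≠ 0 ∧ ∀ y ∈ C, f y ≤ f x := by
  by_cases hspan : Submodule.span ℝ C = ⊤
  -- A spanning convex set through 0 has nonempty interior in coordinates; strict separation from
  -- the interior becomes weak separation on its closure, which contains the set.
  · let e := (Module.finBasis ℝ E).equivFun
    have hD : Convex ℝ (e.symm ⁻¹' C) := hC.linear_preimage e.symm.toLinearMap
    have h0D : (0 : _) ∈ e.symm ⁻¹' C := by simpa using h0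
    have hne : (interior (e.symm ⁻¹' C)).Nonempty := by
      rw [hD.interior_nonempty_iff_affineSpan_eq_top, ← Set.insert_eq_of_mem h0D]
      apply SetLike.coe_injective
      rw [affineSpan_insert_zero, ← e.image_eq_preimage_symm]
      have : Submodule.span ℝ (e '' C) = ⊤ := by
        rw [← LinearEquiv.coe_coe, Submodule.span_image, hspan, Submodule.map_top,
          LinearEquiv.range]
      rw [this]
      simp
    have hxD : e x ∉ interior (e.symm ⁻¹' C) := fun h => hx (by simpa using interior_subset h)
    obtain ⟨f, hf⟩ := geometric_hahn_banach_open_point hD.interior isOpen_interior hxD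
    refine ⟨f.toLinearMap ∘ₗ e.toLinearMap, ?_, fun y hy => ?_⟩
    · rintro h
      obtain ⟨z, hz⟩ := hne
      have hlt := hf z hz
      have h1 := LinearMap.congr_fun h x
      have h2 := LinearMap.congr_fun h (e.symm z)
      simp at h1 h2
      linarith
    · have hcl : e y ∈ closure (interior (e.symm ⁻¹' C)) := by
        rw [hD.closure_interior_eq_closure_of_nonempty_interior hne]
        exact subset_closure (by simpa using hy)
      exact le_on_closure (f := f) (g := fun _ => f (e x)) (fun z hz => (hf z hz).le)
        f.continuous.continuousOn continuousOn_const hcl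
  -- Here the set lies in a proper subspace: a functional vanishing there separates once its sign is
  -- chosen.
  · obtain ⟨f, hf, hker⟩ := Submodule.exists_le_ker_of_lt_top _ (lt_top_iff_ne_top.2 hspan)
    have hv : ∀ y ∈ C, f y = 0 := fun y hy => hker (Submodule.subset_span hy)
    obtain h | h := le_total 0 (f x)
    · exact ⟨f, hf, fun y hy => (hv y hy).trans_le h⟩
    · exact ⟨-f, neg_ne_zero.2 hf, fun y hy => by simpa [hv y hy] using h⟩

/-- The isomorphic copy carries the norm `p` without clashing with a topology already present on
`E`, so norm estimates can be pulled back along `e`. -/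
theorem Seminorm.exists_normedSpace_linearEquiv.{u} {E : Type u} [AddCommGroup E] [Module ℝ E]
    (p : Seminorm ℝ E) (hp : ∀ x, p x = 0 → x = 0) :
    ∃ (F : Type u) (_ : NormedAddCommGroup F) (_ : NormedSpace ℝ F) (e : E ≃ₗ[ℝ] F),
      ∀ x, ‖e x‖ = p x := by
  let : Norm E := ⟨p⟩
  have core : NormedSpace.Core ℝ E :=
    { norm_nonneg := fun x => apply_nonneg p x
      norm_smul := fun c x => map_smul_eq_mul p c x
      norm_triangle := fun x y => map_add_le_add p x y
      norm_eq_zero_iff := fun x => ⟨hp x, fun h => by subst h; exact map_zero p⟩ }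
  let := NormedAddCommGroup.ofCore core
  exact ⟨E, NormedAddCommGroup.ofCore core, NormedSpace.ofCore core, LinearEquiv.refl ℝ E,
    fun x => rfl⟩

theorem Seminorm.continuous_of_definite {E : Type*} [AddCommGroup E] [Module ℝ E]
    [TopologicalSpace E] [IsTopologicalAddGroup E] [ContinuousSMul ℝ E] [T2Space E]
    [FiniteDimensional ℝ E] (p : Seminorm ℝ E) (hp : ∀ x, p x = 0 → x = 0) : Continuous p := by
  obtain ⟨F, _, _, e, he⟩ := p.exists_normedSpace_linearEquiv hp
  have h : (p : E → ℝ) = fun x => ‖e x‖ := funext fun x => (he x).symm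
  rw [h]
  exact (LinearMap.continuous_of_finiteDimensional e.toLinearMap).norm

theorem Seminorm.exists_forall_le_mul_of_definite {E : Type*} [AddCommGroup E] [Module ℝ E]
    [FiniteDimensional ℝ E] (p : Seminorm ℝ E) (hp : ∀ x, p x = 0 → x = 0) (f : E →ₗ[ℝ] ℝ) :
    ∃ C : ℝ, ∀ x, f x ≤ C * p x := by
  obtain ⟨F, _, _, e, he⟩ := p.exists_normedSpace_linearEquiv hp
  have : FiniteDimensional ℝ F := e.finiteDimensional
  let g : F →L[ℝ] ℝ := LinearMap.toContinuousLinearMap (f ∘ₗ e.symm.toLinearMap)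
  refine ⟨‖g‖, fun x => ?_⟩
  have h1 := (le_abs_self _).trans (g.le_opNorm (e x))
  have h2 : g (e x) = f x := by simp [g]
  rwa [h2, he] at h1

/-- Hahn–Banach, extending c • x ↦ c * p x from the line through `x`; the sublinear form needs no
topology. -/
theorem Seminorm.exists_dual_le_eq {E : Type*} [AddCommGroup E] [Module ℝ E]
    (p : Seminorm ℝ E) (x : E) : ∃ f : E →ₗ[ℝ] ℝ, (∀ y, f y ≤ p y) ∧ f x = p x := by
  obtain rfl | hx := eq_or_ne x 0
  · exact ⟨0, fun y => by simp, by simp⟩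
  obtain ⟨g, hg, hgp⟩ := exists_extension_of_le_sublinear
    (LinearPMap.mkSpanSingleton x (p x) hx) p
    (fun c hc y => by simp [map_smul_eq_mul, abs_of_pos hc]) (fun y z => map_add_le_add p y z)
    (by
      rintro ⟨y, hy⟩
      obtain ⟨c, rfl⟩ := Submodule.mem_span_singleton.1 hy
      simp only [LinearPMap.mkSpanSingleton, LinearPMap.mkSpanSingleton'_apply, smul_eq_mul,
        map_smul_eq_mul]
      exact mul_le_mul_of_nonneg_right (le_abs_self c) (apply_nonneg p x))
  refine ⟨g, hgp, ?_⟩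
  have h := hg ⟨x, Submodule.mem_span_singleton_self x⟩
  exact h.trans (LinearPMap.mkSpanSingleton'_apply_self _ _ _ _)

/-! ### Self-duality of the positive semidefinite cone. -/

/-- Writing A as a sum of terms v vᵀ turns the trace into a sum of vᵀ B v. -/
theorem Matrix.PosSemidef.trace_mul_nonneg {n : Type*} [Fintype n]
    {A B : Matrix n n ℝ} (hA : A.PosSemidef) (hB : B.PosSemidef) : 0 ≤ (A * B).trace := by
  obtain ⟨m, v, rfl⟩ := Matrix.posSemidef_iff_eq_sum_vecMulVec.1 hA
  rw [Finset.sum_mul, Matrix.trace_sum]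
  refine Finset.sum_nonneg fun i _ => ?_
  rw [Matrix.vecMulVec_mul, Matrix.trace_vecMulVec, dotProduct_comm, ← Matrix.dotProduct_mulVec]
  simpa using hB.dotProduct_mulVec_nonneg (v i)

theorem Matrix.posSemidef_of_forall_trace_nonneg {n : Type*} [Fintype n]
    {Z : Matrix n n ℝ} (hZ : Z.IsSymm)
    (h : ∀ P : Matrix n n ℝ, P.PosSemidef → 0 ≤ (Pᵀ * Z).trace) : Z.PosSemidef := by
  refine Matrix.PosSemidef.of_dotProduct_mulVec_nonneg (by simpa [Matrix.IsHermitian] using hZ.eq) fun x => ?_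
  have := h _ (Matrix.posSemidef_vecMulVec_self_star x)
  rw [Matrix.transpose_vecMulVec, Matrix.vecMulVec_mul, Matrix.trace_vecMulVec,
    ← Matrix.mulVec_transpose, hZ.eq] at this
  exact this

/-! ### The pairing, its representation of functionals, and the dual norm. -/

section

variable {K : ℕ}

/-- The pairing as a bilinear map. -/
def pairingBilin (K : ℕ) : GramPair K →ₗ[ℝ] GramPair K →ₗ[ℝ] ℝ :=
  LinearMap.mk₂ ℝ pairing
    (fun V W Z => by simp [pairing, add_mul, Matrix.trace_add, add_dotProduct]; ring)
    (fun r V Z => by simp [pairing, Matrix.trace_smul, smul_dotProduct]; ring)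
    (fun V W Z => by simp [pairing, mul_add, Matrix.trace_add, dotProduct_add]; ring)
    (fun r V Z => by simp [pairing, Matrix.trace_smul, dotProduct_smul]; ring)

theorem pairingBilin_apply (V Z : GramPair K) : pairingBilin K V Z = pairing V Z := rfl

theorem pairing_add_left (V W Z : GramPair K) :
    pairing (V + W) Z = pairing V Z + pairing W Z := (pairingBilin K).map_add₂ V W Z

theorem pairing_sub_left (V W Z : GramPair K) :
    pairing (V - W) Z = pairing V Z - pairing W Z := (pairingBilin K).map_sub₂ V W Z

theorem pairing_neg_left (V Z : GramPair K) : pairing (-V) Z = -pairing V Z :=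
  (pairingBilin K).map_neg₂ V Z

theorem pairing_smul_left (r : ℝ) (V Z : GramPair K) :
    pairing (r • V) Z = r * pairing V Z := (pairingBilin K).map_smul₂ r V Z

theorem pairing_zero_left (Z : GramPair K) : pairing 0 Z = 0 :=
  (pairingBilin K).map_zero₂ Z

theorem pairing_add_right (V W Z : GramPair K) :
    pairing V (W + Z) = pairing V W + pairing V Z := (pairingBilin K V).map_add W Z

theorem pairing_sub_right (V W Z : GramPair K) :
    pairing V (W - Z) = pairing V W - pairing V Z := (pairingBilin K V).map_sub W Z

theorem pairing_smul_right (r : ℝ) (V Z : GramPair K) :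
    pairing V (r • Z) = r * pairing V Z := (pairingBilin K V).map_smul r Z

theorem pairing_zero_right (V : GramPair K) : pairing V 0 = 0 := (pairingBilin K V).map_zero

theorem pairing_comm (V Z : GramPair K) : pairing V Z = pairing Z V := by
  unfold pairing
  rw [dotProduct_comm, ← Matrix.trace_transpose, Matrix.transpose_mul, Matrix.transpose_transpose]

theorem continuous_pairing (V : GramPair K) : Continuous (pairing V) :=
  (pairingBilin K V).continuous_of_finiteDimensional

theorem eq_zero_of_pairing_self {Z : GramPair K} (h : pairing Z Z = 0) : Z = 0 := by
  have h1 : 0 ≤ ((Z.1 : Matrix (Fin (K + 2)) (Fin (K + 2)) ℝ)ᵀ *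
      (Z.1 : Matrix (Fin (K + 2)) (Fin (K + 2)) ℝ)).trace :=
    (Matrix.posSemidef_conjTranspose_mul_self _).trace_nonneg
  have h2 : 0 ≤ Z.2 ⬝ᵥ Z.2 := Finset.sum_nonneg fun i _ => mul_self_nonneg _
  unfold pairing at h
  have h3 := Matrix.trace_conjTranspose_mul_self_eq_zero_iff
    (A := (Z.1 : Matrix (Fin (K + 2)) (Fin (K + 2)) ℝ)) |>.1 (by
      rw [Matrix.conjTranspose_eq_transpose_of_trivial]; linarith)
  exact Prod.ext (Subtype.ext h3) (dotProduct_self_eq_zero.1 (by linarith))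

/-- Every linear functional on the lifted space is represented by the pairing. -/
theorem exists_pairing_eq (f : GramPair K →ₗ[ℝ] ℝ) : ∃ Z : GramPair K, ∀ V, f V = pairing V Z := by
  have hinj : Function.Injective (pairingBilin K) := by
    refine (injective_iff_map_eq_zero _).2 fun Z hZ => eq_zero_of_pairing_self ?_
    rw [← pairingBilin_apply, hZ, LinearMap.zero_apply]
  have hsurj := (LinearMap.injective_iff_surjective_of_finrank_eq_finrank
    (Subspace.dual_finrank_eq (K := ℝ) (V := GramPair K)).symm).1 hinj
  obtain ⟨Z, hZ⟩ := hsurj f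
  exact ⟨Z, fun V => by rw [pairing_comm, ← pairingBilin_apply, hZ]⟩

section DualNorm

variable (nrm : Seminorm ℝ (GramPair K))

theorem dualNorm_le {V : GramPair K} {C : ℝ} (h : ∀ Z, nrm Z ≤ 1 → pairing V Z ≤ C) :
    dualNorm nrm V ≤ C := by
  refine csSup_le ⟨0, 0, by simp, (pairing_zero_right V).symm⟩ ?_
  rintro _ ⟨Z, hZ, rfl⟩
  exact h Z hZ

/-- Since `dualNorm` is a real `sSup`, the set must be shown bounded above; definiteness in finite
dimension provides this. -/
theorem pairing_le_dualNorm_mul (hnrm : ∀ Z, nrm Z = 0 → Z = 0) (V Z : GramPair K) :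
    pairing V Z ≤ dualNorm nrm V * nrm Z := by
  obtain rfl | hZ := eq_or_ne Z 0
  · simp [pairing_zero_right]
  have hpos : 0 < nrm Z := (apply_nonneg nrm Z).lt_of_ne fun h => hZ (hnrm Z h.symm)
  obtain ⟨C, hC⟩ := nrm.exists_forall_le_mul_of_definite hnrm (pairingBilin K V)
  have hbdd : BddAbove {r : ℝ | ∃ Z : GramPair K, nrm Z ≤ 1 ∧ r = pairing V Z} := by
    refine ⟨max C 0, ?_⟩
    rintro _ ⟨W, hW, rfl⟩
    calc pairing V W ≤ C * nrm W := hC W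
      _ ≤ max C 0 * nrm W := by gcongr; exact le_max_left _ _
      _ ≤ max C 0 * 1 := by gcongr
      _ = max C 0 := mul_one _
  have h1 : pairing V ((nrm Z)⁻¹ • Z) ≤ dualNorm nrm V :=
    le_csSup hbdd ⟨_, by
      rw [map_smul_eq_mul, Real.norm_of_nonneg (by positivity), inv_mul_cancel₀ hpos.ne'], rfl⟩
  rw [pairing_smul_right, inv_mul_le_iff₀ hpos] at h1
  linarith

theorem exists_pairing_le_seminorm_pairing_eq (Z : GramPair K) :
    ∃ X : GramPair K, (∀ W, pairing X W ≤ nrm W) ∧ pairing X Z = nrm Z := by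
  obtain ⟨f, hf, hfZ⟩ := nrm.exists_dual_le_eq Z
  obtain ⟨X, hX⟩ := exists_pairing_eq f
  exact ⟨X, fun W => by rw [pairing_comm, ← hX]; exact hf W, by rw [pairing_comm, ← hX, hfZ]⟩

end DualNorm

end

/-! ### Recession directions of the support and block functionals. -/

section

variable {K : ℕ}

theorem pairing_nonneg_of_posSemidef {W Z : GramPair K}
    (hW : (W.1 : Matrix (Fin (K + 2)) (Fin (K + 2)) ℝ).PosSemidef) (hW2 : W.2 = 0)
    (hZ : (Z.1 : Matrix (Fin (K + 2)) (Fin (K + 2)) ℝ).PosSemidef) : 0 ≤ pairing W Z := by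
  unfold pairing
  rw [hW2, zero_dotProduct, add_zero]
  exact hW.transpose.trace_mul_nonneg hZ

theorem posSemidef_of_forall_pairing_nonneg {Z : GramPair K}
    (h : ∀ W : GramPair K, (W.1 : Matrix (Fin (K + 2)) (Fin (K + 2)) ℝ).PosSemidef → W.2 = 0 →
      0 ≤ pairing W Z) : (Z.1 : Matrix (Fin (K + 2)) (Fin (K + 2)) ℝ).PosSemidef := by
  refine Matrix.posSemidef_of_forall_trace_nonneg Z.1.2 fun P hP => ?_
  have hsymm : P ∈ SymMat (K + 2) := by
    have := hP.isHermitian.eq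
    rwa [Matrix.conjTranspose_eq_transpose_of_trivial] at this
  simpa [pairing] using h (⟨P, hsymm⟩, 0) hP rfl

/-- A compact nonempty support set has trivial recession cone. -/
theorem PEPData.eq_zero_of_mem_recession {M : Type*} (D : PEPData K M)
    (hcompact : IsCompact D.support) {Z₀ : GramPair K} (hZ₀ : Z₀ ∈ D.support) {Z : GramPair K}
    (hpsd : (Z.1 : Matrix (Fin (K + 2)) (Fin (K + 2)) ℝ).PosSemidef)
    (hinterp : ∀ m, pairing (D.interp m) Z ≤ 0) (hinit : pairing D.init Z ≤ 0) : Z = 0 := by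
  have hmem : ∀ n : ℕ, Z₀ + (n : ℝ) • Z ∈ D.support := fun n => by
    have hp : ((Z₀ + (n : ℝ) • Z).1 : Matrix (Fin (K + 2)) (Fin (K + 2)) ℝ).PosSemidef :=
      hZ₀.1.1.add (hpsd.smul n.cast_nonneg)
    refine ⟨⟨hp, fun m => ?_⟩, hp, ?_⟩
    · have h1 := hZ₀.1.2 m
      have h2 := mul_nonneg (n.cast_nonneg (α := ℝ)) (neg_nonneg.2 (hinterp m))
      simp only [PEPData.opS, pairing_add_right, pairing_smul_right] at h1 ⊢
      linarith
    · have h1 := hZ₀.2.2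
      have h2 := mul_nonneg (n.cast_nonneg (α := ℝ)) (neg_nonneg.2 hinit)
      rw [pairing_add_right, pairing_smul_right]
      linarith
  -- The pairing with `Z` itself is bounded on the support but grows linearly along Z₀ + n Z unless
  -- `pairing Z Z = 0`.
  obtain ⟨C, hC⟩ := hcompact.bddAbove_image (continuous_pairing Z).continuousOn
  apply eq_zero_of_pairing_self
  have hnn : 0 ≤ pairing Z Z := by
    unfold pairing
    exact add_nonneg (Matrix.posSemidef_conjTranspose_mul_self _).trace_nonneg
      (Finset.sum_nonneg fun i _ => mul_self_nonneg _)
  by_contra hne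
  obtain ⟨n, hn⟩ := exists_nat_gt ((C - pairing Z Z₀) / pairing Z Z)
  have h1 : pairing Z (Z₀ + (n : ℝ) • Z) ≤ C := hC ⟨_, hmem n, rfl⟩
  rw [pairing_add_right, pairing_smul_right] at h1
  rw [div_lt_iff₀ (hnn.lt_of_ne' hne)] at hn
  linarith

/-- Membership of a positive multiple in the support set, in homogeneous form. -/
theorem PEPData.inv_smul_mem_support {M : Type*} (D : PEPData K M) {Z : GramPair K} {a : ℝ}
    (ha : 0 < a) (hpsd : (Z.1 : Matrix (Fin (K + 2)) (Fin (K + 2)) ℝ).PosSemidef)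
    (hinterp : ∀ m, pairing (D.interp m) Z ≤ 0) (hinit : pairing D.init Z + D.c₀ * a ≤ 0) :
    a⁻¹ • Z ∈ D.support := by
  have hp : ((a⁻¹ • Z).1 : Matrix (Fin (K + 2)) (Fin (K + 2)) ℝ).PosSemidef :=
    hpsd.smul (inv_nonneg.2 ha.le)
  refine ⟨⟨hp, fun m => ?_⟩, hp, ?_⟩
  · rw [PEPData.opS, pairing_smul_right]
    have := mul_nonneg (inv_nonneg.2 ha.le) (neg_nonneg.2 (hinterp m))
    linarith
  · rw [pairing_smul_right]
    have := mul_nonneg (inv_nonneg.2 ha.le) (neg_nonneg.2 hinit)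
    have h2 : a⁻¹ * -(pairing D.init Z + D.c₀ * a) = -(a⁻¹ * pairing D.init Z + D.c₀) := by
      field_simp
    linarith

/-- Linear functionals on the right-hand-side space of a conic program with blocks indexed by `ι`. -/
theorem exists_repr_blocks {ι : Type*} [Fintype ι] [DecidableEq ι]
    (f : ((ι → GramPair K) × (ι → ℝ) × ℝ) →ₗ[ℝ] ℝ) :
    ∃ (Z : ι → GramPair K) (α : ι → ℝ) (μ : ℝ), ∀ V w u,
      f (V, w, u) = ∑ p, pairing (V p) (Z p) + ∑ p, w p * α p - u * μ := by
  have h1 := fun p => exists_pairing_eq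
    (f ∘ₗ LinearMap.inl ℝ _ _ ∘ₗ LinearMap.single ℝ (fun _ : ι => GramPair K) p)
  choose Z hZ using h1
  -- The minus sign anticipates μ ≥ 0: raising the bound u keeps the program feasible.
  refine ⟨Z, fun p => f (0, Pi.single p 1, 0), -f (0, 0, 1), fun V w u => ?_⟩
  have hdec : ((V, w, u) : (ι → GramPair K) × (ι → ℝ) × ℝ) =
      LinearMap.inl ℝ _ _ V + (∑ p, w p • ((0, Pi.single p 1, 0) :
        (ι → GramPair K) × (ι → ℝ) × ℝ)) + u • (0, 0, 1) := by
    refine Prod.ext ?_ (Prod.ext ?_ ?_)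
    · simp [Prod.fst_sum]
    · ext q
      simp [Prod.snd_sum, Prod.fst_sum, Finset.sum_apply, Pi.single_apply]
    · simp [Prod.snd_sum]
  have hV : f (LinearMap.inl ℝ _ _ V) = ∑ p, pairing (V p) (Z p) := by
    simp_rw [← hZ]
    simp only [LinearMap.comp_apply, ← map_sum]
    congr 2
    ext q : 1
    simp
  rw [hdec, map_add, map_add, hV, map_sum, map_smul]
  simp only [map_smul, smul_eq_mul]
  ring

end

/-! ### The cone of feasible right-hand sides and strong duality. -/

section

variable {K : ℕ}

/-- The right-hand sides `(V, w, u)` for which the conic program, with objective vectors `V`,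
epigraph constraints shifted by `w` and objective bound `u`, is feasible. The dual norm constraint
is stated as domination of the functional by `λ ‖·‖`. -/
def dualCone {N J : ℕ} {M : Type*} [Fintype M] (D : PEPData K M)
    (nrm : Seminorm ℝ (GramPair K)) (Zhat : Fin N → GramPair K) (ε : ℝ) (c : Fin J → ℝ) :
    Set ((Fin N × Fin J → GramPair K) × (Fin N × Fin J → ℝ) × ℝ) :=
  {x | ∃ v : DROVars K N J M, 0 ≤ v.lam ∧ (∀ i j, 0 ≤ v.τ i j) ∧ (∀ i j m, 0 ≤ v.y i j m) ∧
    (∀ i j W, pairing (v.XY i j) W ≤ v.lam * nrm W) ∧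
    (∀ i j, c j * v.t - D.c₀ * v.τ i j - pairing (v.XY i j) (Zhat i) + v.lam * ε + x.2.1 (i, j)
      ≤ v.s i) ∧
    (∀ i j, ∃ W : GramPair K, (W.1 : Matrix (Fin (K + 2)) (Fin (K + 2)) ℝ).PosSemidef ∧
      W.2 = 0 ∧ W = -D.opSAdj (v.y i j) - v.XY i j + v.τ i j • D.init - x.1 (i, j)) ∧
    1 / (N : ℝ) * ∑ i, v.s i ≤ x.2.2}

variable {N J : ℕ} {M : Type*} [Fintype M] (D : PEPData K M) (nrm : Seminorm ℝ (GramPair K))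
  (Zhat : Fin N → GramPair K) (ε : ℝ) (c : Fin J → ℝ)

theorem PEPData.opSAdj_add (y z : M → ℝ) : D.opSAdj (y + z) = D.opSAdj y + D.opSAdj z := by
  simp [PEPData.opSAdj, add_smul, Finset.sum_add_distrib, add_comm]

theorem PEPData.opSAdj_smul (r : ℝ) (y : M → ℝ) : D.opSAdj (r • y) = r • D.opSAdj y := by
  simp [PEPData.opSAdj, mul_smul, Finset.smul_sum]

theorem PEPData.opSAdj_zero : D.opSAdj 0 = 0 := by simp [PEPData.opSAdj]

theorem add_mem_dualCone {x x' : (Fin N × Fin J → GramPair K) × (Fin N × Fin J → ℝ) × ℝ}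
    (hx : x ∈ dualCone D nrm Zhat ε c) (hx' : x' ∈ dualCone D nrm Zhat ε c) :
    x + x' ∈ dualCone D nrm Zhat ε c := by
  obtain ⟨v, h1, h2, h3, h4, h5, h6, h7⟩ := hx
  obtain ⟨v', h1', h2', h3', h4', h5', h6', h7'⟩ := hx'
  refine ⟨⟨v.s + v'.s, v.t + v'.t, v.lam + v'.lam, v.τ + v'.τ, v.y + v'.y, v.XY + v'.XY⟩,
    add_nonneg h1 h1', fun i j => add_nonneg (h2 i j) (h2' i j),
    fun i j m => add_nonneg (h3 i j m) (h3' i j m), fun i j W => ?_, fun i j => ?_,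
    fun i j => ?_, ?_⟩
  · have := h4 i j W
    have := h4' i j W
    simp only [Pi.add_apply, pairing_add_left]
    linarith
  · have := h5 i j
    have := h5' i j
    simp only [Pi.add_apply, pairing_add_left, Prod.fst_add, Prod.snd_add]
    linarith
  · obtain ⟨W, hW, hW2, hWe⟩ := h6 i j
    obtain ⟨W', hW', hW2', hWe'⟩ := h6' i j
    refine ⟨W + W', hW.add hW', by simp [hW2, hW2'], ?_⟩
    simp only [Pi.add_apply, Prod.fst_add, PEPData.opSAdj_add, hWe, hWe', add_smul]
    abel
  · simp only [Pi.add_apply, Finset.sum_add_distrib, Prod.snd_add]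
    linarith

theorem smul_mem_dualCone {x : (Fin N × Fin J → GramPair K) × (Fin N × Fin J → ℝ) × ℝ}
    (hx : x ∈ dualCone D nrm Zhat ε c) {r : ℝ} (hr : 0 ≤ r) :
    r • x ∈ dualCone D nrm Zhat ε c := by
  obtain ⟨v, h1, h2, h3, h4, h5, h6, h7⟩ := hx
  refine ⟨⟨r • v.s, r * v.t, r * v.lam, r • v.τ, r • v.y, r • v.XY⟩,
    mul_nonneg hr h1, fun i j => mul_nonneg hr (h2 i j),
    fun i j m => mul_nonneg hr (h3 i j m), fun i j W => ?_, fun i j => ?_,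
    fun i j => ?_, ?_⟩
  · have := mul_le_mul_of_nonneg_left (h4 i j W) hr
    simp only [Pi.smul_apply, pairing_smul_left]
    linarith
  · have := mul_le_mul_of_nonneg_left (h5 i j) hr
    simp only [Pi.smul_apply, pairing_smul_left, Prod.smul_fst, Prod.smul_snd, smul_eq_mul]
    linarith
  · obtain ⟨W, hW, hW2, hWe⟩ := h6 i j
    refine ⟨r • W, hW.smul hr, by simp [hW2], ?_⟩
    simp only [Pi.smul_apply, Prod.smul_fst, PEPData.opSAdj_smul, hWe, smul_eq_mul]
    module
  · have := mul_le_mul_of_nonneg_left h7 hr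
    simp only [Pi.smul_apply, Prod.smul_snd, smul_eq_mul, ← Finset.mul_sum]
    linarith

theorem zero_mem_dualCone : 0 ∈ dualCone D nrm Zhat ε c := by
  refine ⟨⟨0, 0, 0, 0, 0, 0⟩, le_rfl, fun _ _ => le_rfl, fun _ _ _ => le_rfl, fun i j W => ?_,
    fun i j => ?_, fun i j => ⟨0, Matrix.PosSemidef.zero, rfl, ?_⟩, ?_⟩ <;>
  simp [pairing_zero_left, PEPData.opSAdj_zero]

theorem convex_dualCone : Convex ℝ (dualCone (J := J) D nrm Zhat ε c) :=
  fun _ hx _ hy _ _ ha hb _ => add_mem_dualCone D nrm Zhat ε c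
    (smul_mem_dualCone D nrm Zhat ε c hx ha) (smul_mem_dualCone D nrm Zhat ε c hy hb)

/-- These test elements activate one block only, so a functional's sign on the cone can be read off
block by block. -/
theorem single_mem_dualCone (p : Fin N × Fin J) {τ : ℝ} (hτ : 0 ≤ τ) {y : M → ℝ}
    (hy : ∀ m, 0 ≤ y m) {W : GramPair K}
    (hW : (W.1 : Matrix (Fin (K + 2)) (Fin (K + 2)) ℝ).PosSemidef) (hW2 : W.2 = 0) {w : ℝ}
    (hw : w ≤ D.c₀ * τ) :
    (Pi.single p (-D.opSAdj y + τ • D.init - W), Pi.single p w, 0) ∈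
      dualCone D nrm Zhat ε c := by
  refine ⟨⟨0, 0, 0, fun i j => if (i, j) = p then τ else 0,
    fun i j => if (i, j) = p then y else 0, 0⟩, le_rfl, fun i j => ?_, fun i j m => ?_,
    fun i j W => ?_, fun i j => ?_, fun i j => ⟨if (i, j) = p then W else 0, ?_, ?_, ?_⟩, ?_⟩
  · dsimp only; split_ifs <;> simp [hτ]
  · dsimp only; split_ifs <;> simp [hy]
  · simp [pairing_zero_left]
  · by_cases h : (i, j) = p <;> simp [h, pairing_zero_left, hw]
  · split_ifs
    exacts [hW, Matrix.PosSemidef.zero]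
  · split_ifs
    exacts [hW2, rfl]
  · by_cases h : (i, j) = p <;> simp [h, PEPData.opSAdj_zero]
  · simp

/-- The conditions on a functional that is nonpositive on `dualCone`: the homogenized constraints
of the maximization problem. -/
theorem homogenized_constraints_of_nonpos {Z : Fin N × Fin J → GramPair K}
    {α : Fin N × Fin J → ℝ} {μ : ℝ}
    (h : ∀ V w u, (V, w, u) ∈ dualCone D nrm Zhat ε c →
      ∑ p, pairing (V p) (Z p) + ∑ p, w p * α p - u * μ ≤ 0) :
    (∀ p, 0 ≤ α p) ∧ 0 ≤ μ ∧
    (∀ p, ((Z p).1 : Matrix (Fin (K + 2)) (Fin (K + 2)) ℝ).PosSemidef) ∧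
    (∀ p m, pairing (D.interp m) (Z p) ≤ 0) ∧
    (∀ p, pairing D.init (Z p) + D.c₀ * α p ≤ 0) ∧
    (∀ i, ∑ j, α (i, j) = μ * (1 / (N : ℝ))) ∧ (∑ j, (∑ i, α (i, j)) * c j = 0) ∧
    ∑ i, ∑ j, nrm (Z (i, j) - α (i, j) • Zhat i) ≤ ε * ∑ i, ∑ j, α (i, j) := by
  classical
  have hsingle : ∀ (p : Fin N × Fin J) (τ : ℝ) (y : M → ℝ) (W : GramPair K) (w : ℝ), 0 ≤ τ →
      (∀ m, 0 ≤ y m) → (W.1 : Matrix (Fin (K + 2)) (Fin (K + 2)) ℝ).PosSemidef → W.2 = 0 →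
      w ≤ D.c₀ * τ → pairing (-D.opSAdj y + τ • D.init - W) (Z p) + w * α p ≤ 0 := by
    intro p τ y W w hτ hy hW hW2 hw
    have := h _ _ _ (single_mem_dualCone D nrm Zhat ε c p hτ hy hW hW2 hw)
    rw [Finset.sum_eq_single p, Finset.sum_eq_single p] at this
    · simpa using this
    all_goals simp +contextual [pairing_zero_left]
  -- Here s and t have no sign restriction, so testing with both signs yields the two equality
  -- constraints on α.
  have hscalar : ∀ (s : Fin N → ℝ) (t : ℝ),
      ∑ i, ∑ j, (s i - c j * t) * α (i, j) - 1 / (N : ℝ) * (∑ i, s i) * μ ≤ 0 := by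
    intro s t
    have := h 0 (fun p => s p.1 - c p.2 * t) (1 / (N : ℝ) * ∑ i, s i)
      ⟨⟨s, t, 0, 0, 0, 0⟩, le_rfl, fun _ _ => le_rfl, fun _ _ _ => le_rfl,
        fun _ _ _ => by simp [pairing_zero_left], fun _ _ => by simp [pairing_zero_left],
        fun _ _ => ⟨0, Matrix.PosSemidef.zero, rfl, by simp [PEPData.opSAdj_zero]⟩, le_rfl⟩
    simpa [pairing_zero_left, Fintype.sum_prod_type] using this
  refine ⟨fun p => ?_, ?_, fun p => ?_, fun p m => ?_, fun p => ?_, fun i => ?_, ?_, ?_⟩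
  · have := hsingle p 0 0 0 (-1) le_rfl (fun _ => le_rfl) Matrix.PosSemidef.zero rfl (by simp)
    simpa [PEPData.opSAdj_zero, pairing_zero_left] using this
  · have := h 0 0 1 ⟨⟨0, 0, 0, 0, 0, 0⟩, le_rfl, fun _ _ => le_rfl, fun _ _ _ => le_rfl,
        fun _ _ _ => by simp [pairing_zero_left], fun _ _ => by simp [pairing_zero_left],
        fun _ _ => ⟨0, Matrix.PosSemidef.zero, rfl, by simp [PEPData.opSAdj_zero]⟩, by simp⟩
    simpa [pairing_zero_left] using this
  · refine posSemidef_of_forall_pairing_nonneg fun W hW hW2 => ?_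
    have := hsingle p 0 0 W 0 le_rfl (fun _ => le_rfl) hW hW2 (by simp)
    simpa [PEPData.opSAdj_zero, pairing_neg_left] using this
  · have := hsingle p 0 (Pi.single m 1) 0 0 le_rfl
      (fun m' => by by_cases hm : m' = m <;> simp [hm])
      Matrix.PosSemidef.zero rfl (by simp)
    simpa [PEPData.opSAdj, Pi.single_apply] using this
  · have := hsingle p 1 0 0 D.c₀ zero_le_one (fun _ => le_rfl) Matrix.PosSemidef.zero rfl (by simp)
    simpa [PEPData.opSAdj_zero] using this
  · have h1 := hscalar (Pi.single i 1) 0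
    have h2 := hscalar (Pi.single i (-1)) 0
    simp [Pi.single_apply] at h1 h2
    rw [one_div, mul_comm]
    linarith
  · have h1 := hscalar 0 1
    have h2 := hscalar 0 (-1)
    simp at h1 h2
    have : ∑ j, (∑ i, α (i, j)) * c j = ∑ i, ∑ j, c j * α (i, j) := by
      rw [Finset.sum_comm]
      simp only [← Finset.mul_sum, mul_comm]
    linarith
  -- Norming functionals of the differences Z_p - α_p Ẑ_i, taken with λ = 1, test all blocks at
  -- once; w is chosen so that every epigraph constraint is tight.
  · choose X hX hXe using fun p : Fin N × Fin J =>
      exists_pairing_le_seminorm_pairing_eq nrm (Z p - α p • Zhat p.1)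
    have := h X (fun p => -pairing (X p) (Zhat p.1) - ε) 0
      ⟨⟨0, 0, 1, 0, 0, fun i j => -X (i, j)⟩, zero_le_one, fun _ _ => le_rfl, fun _ _ _ => le_rfl,
        fun i j W => by
          rw [one_mul, ← map_neg_eq_map nrm W, pairing_neg_left]
          have := hX (i, j) (-W)
          rwa [pairing_comm, pairing_neg_left, pairing_comm] at this,
        fun i j => by simp [pairing_neg_left],
        fun i j => ⟨0, Matrix.PosSemidef.zero, rfl, by simp [PEPData.opSAdj_zero]⟩, by simp⟩
    simp only [← hXe, pairing_sub_right, pairing_smul_right, Finset.mul_sum]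
    rw [← sub_nonpos, ← Finset.sum_sub_distrib]
    simp only [Fintype.sum_prod_type, zero_mul, sub_zero] at this
    rw [← Finset.sum_add_distrib] at this
    refine le_trans (le_of_eq (Finset.sum_congr rfl fun i _ => ?_)) this
    rw [← Finset.sum_sub_distrib, ← Finset.sum_add_distrib]
    exact Finset.sum_congr rfl fun j _ => by ring

/-- Theorem of alternatives behind strong duality: each level `r` is reached by the conic program
from above or by the maximization problem from below. -/
theorem dro_alternative [NeZero N] (hcompact : IsCompact D.support) (Zhat : Fin N → D.support)
    (obj : Fin J → GramPair K) (r : ℝ) :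
    (∃ v : DROVars K N J M, v.Feasible D nrm Zhat ε obj c ∧ 1 / (N : ℝ) * ∑ i, v.s i ≤ r) ∨
    ∃ (α : Fin N → Fin J → ℝ) (Z : Fin N → Fin J → D.support), α ∈ weightSet N c ∧
      ∑ i, ∑ j, α i j * nrm ((Z i j : GramPair K) - (Zhat i : GramPair K)) ≤ ε ∧
      r ≤ ∑ i, ∑ j, α i j * pairing (obj j) (Z i j : GramPair K) := by
  classical
  by_cases hmem : ((fun p => obj p.2, 0, r) :
      (Fin N × Fin J → GramPair K) × (Fin N × Fin J → ℝ) × ℝ) ∈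
      dualCone D nrm (fun i => (Zhat i : GramPair K)) ε c
  · left
    obtain ⟨v, h1, h2, h3, h4, h5, h6, h7⟩ := hmem
    refine ⟨v, ⟨h1, h2, h3, fun i j => by simpa using h5 i j, fun i j => ?_, fun i j => ?_⟩, h7⟩
    · obtain ⟨W, hW, hW2, hWe⟩ := h6 i j
      subst hWe
      exact ⟨hW, hW2⟩
    · exact dualNorm_le nrm fun W hW => (h4 i j W).trans (mul_le_of_le_one_right h1 hW)
  right
  obtain ⟨f, hf0, hf⟩ := (convex_dualCone D nrm (fun i => (Zhat i : GramPair K)) ε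
    c).exists_dual_ne_zero_le_of_notMem (zero_mem_dualCone D nrm _ ε c) hmem
  -- A functional bounded above on a cone is nonpositive there.
  have hf_nonpos : ∀ x ∈ dualCone D nrm (fun i => (Zhat i : GramPair K)) ε c, f x ≤ 0 := by
    intro x hx
    by_contra! hpos
    obtain ⟨n, hn⟩ := exists_nat_gt (f (fun p => obj p.2, 0, r) / f x)
    have h1 := hf _ (smul_mem_dualCone D nrm _ ε c hx n.cast_nonneg)
    rw [map_smul, smul_eq_mul] at h1
    rw [div_lt_iff₀ hpos] at hn
    exact absurd h1 hn.not_ge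
  have hf_nonneg := hf 0 (zero_mem_dualCone D nrm _ ε c)
  obtain ⟨Z, α, μ, hrep⟩ := exists_repr_blocks f
  rw [map_zero, hrep] at hf_nonneg
  obtain ⟨hα, hμ, hpsd, hinterp, hinit, hsum, hc, hnorm⟩ :=
    homogenized_constraints_of_nonpos D nrm (fun i => (Zhat i : GramPair K)) ε c
      fun V w u hx => by rw [← hrep]; exact hf_nonpos _ hx
  -- A block of zero weight is a recession direction of the support.
  have hZ0 : ∀ p, α p = 0 → Z p = 0 := fun p hp =>
    D.eq_zero_of_mem_recession hcompact (Zhat 0).2 (hpsd p) (hinterp p) (by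
      simpa [hp] using hinit p)
  have hNpos : (0 : ℝ) < N := Nat.cast_pos.2 (Nat.pos_of_neZero N)
  -- This is where a constraint qualification would usually enter; compactness replaces it.
  have hμpos : 0 < μ := by
    refine hμ.lt_of_ne' fun hμ0 => hf0 ?_
    have hα0 : ∀ p, α p = 0 := fun p => by
      have := (Finset.sum_eq_zero_iff_of_nonneg fun j _ => hα (p.1, j)).1
        ((hsum p.1).trans (by rw [hμ0, zero_mul]))
      exact this p.2 (Finset.mem_univ _)
    refine LinearMap.ext fun x => ?_
    have := hrep x.1 x.2.1 x.2.2
    simpa [hμ0, hα0, fun p => hZ0 p (hα0 p), pairing_zero_right] using this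
  have hZ' : ∀ i j, ∃ Z' : D.support, α (i, j) • (Z' : GramPair K) = Z (i, j) := fun i j => by
    obtain h0 | h0 := (hα (i, j)).eq_or_lt
    -- With zero weight any support point serves.
    · exact ⟨Zhat i, by rw [← h0, hZ0 _ h0.symm, zero_smul]⟩
    · exact ⟨⟨_, D.inv_smul_mem_support h0 (hpsd _) (hinterp _) (hinit _)⟩,
        smul_inv_smul₀ h0.ne' _⟩
  choose Z' hZ' using hZ'
  refine ⟨fun i j => α (i, j) / μ, Z', ⟨fun i j => div_nonneg (hα _) hμ, fun i => ?_, ?_⟩, ?_, ?_⟩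
  · rw [← Finset.sum_div, hsum, mul_div_cancel_left₀ _ hμpos.ne']
  · simp only [← Finset.sum_div, div_mul_eq_mul_div, hc, zero_div]
  · have h1 : ∀ i j, α (i, j) / μ * nrm ((Z' i j : GramPair K) - (Zhat i : GramPair K)) =
        nrm (Z (i, j) - α (i, j) • (Zhat i : GramPair K)) / μ := fun i j => by
      have h2 : Z (i, j) - α (i, j) • (Zhat i : GramPair K) =
          α (i, j) • ((Z' i j : GramPair K) - (Zhat i : GramPair K)) := by
        rw [← hZ', smul_sub]
      rw [h2, map_smul_eq_mul, Real.norm_of_nonneg (hα _), div_mul_eq_mul_div]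
    simp only [h1, ← Finset.sum_div]
    rw [div_le_iff₀ hμpos]
    refine hnorm.trans_eq ?_
    simp only [hsum, Finset.sum_const, Finset.card_univ, Fintype.card_fin, nsmul_eq_mul]
    field_simp
  · have h1 : ∀ i j, α (i, j) / μ * pairing (obj j) (Z' i j : GramPair K) =
        pairing (obj j) (Z (i, j)) / μ := fun i j => by
      rw [← hZ', pairing_smul_right, div_mul_eq_mul_div]
    simp only [h1, ← Finset.sum_div]
    rw [le_div_iff₀ hμpos]
    simpa [Fintype.sum_prod_type] using hf_nonneg

/-- A strict gap would contain a real level r, which the alternative excludes; infinite values need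
no separate treatment. -/
theorem droPepValue_le_maximizationValue [NeZero N] (hcompact : IsCompact D.support)
    (Zhat : Fin N → D.support) (obj : Fin J → GramPair K) :
    droPepValue D nrm Zhat ε obj c ≤ maximizationValue nrm Zhat ε obj c := by
  by_contra! hlt
  obtain ⟨r, hr1, hr2⟩ := EReal.lt_iff_exists_real_btwn.1 hlt
  obtain ⟨v, hv, hle⟩ | ⟨α, Z, hα, hn, hle⟩ := dro_alternative D nrm ε c hcompact Zhat obj r
  · exact absurd hr2 (not_lt.2 ((iInf₂_le v hv).trans (EReal.coe_le_coe_iff.2 hle)))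
  · refine absurd hr1 (not_lt.2 ((EReal.coe_le_coe_iff.2 hle).trans ?_))
    exact le_iSup_of_le α (le_iSup_of_le Z (le_iSup_of_le ⟨hα, hn⟩ le_rfl))

end

/-! ### Discrete distributions, couplings and Wasserstein weak duality. -/

section

variable {K N J : ℕ} {S : Set (GramPair K)}

theorem isProbabilityMeasure_empirical [NeZero N] (Zhat : Fin N → S) :
    IsProbabilityMeasure (empirical Zhat) := by
  refine ⟨?_⟩
  simp only [empirical, Measure.smul_apply, Measure.finsetSum_apply, measure_univ, Finset.sum_const,
    Finset.card_univ, Fintype.card_fin, nsmul_eq_mul, mul_one, smul_eq_mul]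
  exact ENNReal.inv_mul_cancel (by simpa using NeZero.ne N) (ENNReal.natCast_ne_top N)

theorem integral_empirical (Zhat : Fin N → S) {f : S → ℝ} (hf : StronglyMeasurable f) :
    ∫ Z, f Z ∂(empirical Zhat) = 1 / (N : ℝ) * ∑ i, f (Zhat i) := by
  rw [empirical, integral_smul_measure, integral_finsetSum_measure]
  · simp [integral_dirac' f _ hf]
  · exact fun i _ => integrable_dirac' hf (by simp)

/-- The finitely supported measure with atoms `x p` of masses `α p`. -/
noncomputable def atomicMeasure {ι X : Type*} [Fintype ι] [MeasurableSpace X] (α : ι → ℝ) (x : ι → X) :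
    Measure X := ∑ p, ENNReal.ofReal (α p) • Measure.dirac (x p)

section AtomicMeasure

variable {ι X Y : Type*} [Fintype ι] [MeasurableSpace X] [MeasurableSpace Y]

theorem map_atomicMeasure (α : ι → ℝ) (x : ι → X) {f : X → Y} (hf : Measurable f) :
    (atomicMeasure α x).map f = atomicMeasure α (fun p => f (x p)) := by
  unfold atomicMeasure
  rw [← Measure.mapₗ_apply_of_measurable hf, map_sum]
  refine Finset.sum_congr rfl fun p _ => ?_
  rw [Measure.mapₗ_apply_of_measurable hf, Measure.map_smul, Measure.map_dirac' hf]

theorem isProbabilityMeasure_atomicMeasure {α : ι → ℝ} (x : ι → X) (hα : ∀ p, 0 ≤ α p)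
    (hsum : ∑ p, α p = 1) : IsProbabilityMeasure (atomicMeasure α x) := by
  refine ⟨?_⟩
  simp only [atomicMeasure, Measure.smul_apply, Measure.finsetSum_apply, measure_univ,
    smul_eq_mul, mul_one]
  rw [← ENNReal.ofReal_sum_of_nonneg fun p _ => hα p, hsum, ENNReal.ofReal_one]

theorem integral_atomicMeasure {α : ι → ℝ} (hα : ∀ p, 0 ≤ α p) (x : ι → X) {f : X → ℝ}
    (hf : StronglyMeasurable f) : ∫ z, f z ∂(atomicMeasure α x) = ∑ p, α p * f (x p) := by
  rw [atomicMeasure, integral_finsetSum_measure]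
  · simp [integral_smul_measure, integral_dirac' f _ hf, hα]
  · exact fun p _ => (integrable_dirac' hf (by simp)).smul_measure ENNReal.ofReal_ne_top

theorem lintegral_atomicMeasure (α : ι → ℝ) (x : ι → X) {f : X → ℝ≥0∞} (hf : Measurable f) :
    ∫⁻ z, f z ∂(atomicMeasure α x) = ∑ p, ENNReal.ofReal (α p) * f (x p) := by
  rw [atomicMeasure, lintegral_finsetSum_measure]
  simp [lintegral_smul_measure, lintegral_dirac' _ hf]

end AtomicMeasure

theorem continuous_sup'_pairing [NeZero J] (obj : Fin J → GramPair K) (c : Fin J → ℝ) (t : ℝ) :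
    Continuous fun Z : S => Finset.univ.sup' Finset.univ_nonempty
      fun j => pairing (obj j) (Z : GramPair K) + c j * t :=
  Continuous.finset_sup'_apply _ fun j _ =>
    ((continuous_pairing (obj j)).comp continuous_subtype_val).add continuous_const

theorem maximizationValue_le_worstCaseExpectation [NeZero N] [NeZero J]
    (nrm : Seminorm ℝ (GramPair K)) (hnrm : Continuous nrm) (Zhat : Fin N → S) (ε : ℝ)
    (obj : Fin J → GramPair K) (c : Fin J → ℝ) :
    maximizationValue nrm Zhat ε obj c ≤ worstCaseExpectation nrm Zhat ε obj c := by
  refine iSup_le fun α => iSup_le fun Z => iSup_le fun ⟨⟨hα, hsum, hc⟩, hdist⟩ => ?_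
  let α' : Fin N × Fin J → ℝ := fun p => α p.1 p.2
  let Z' : Fin N × Fin J → S := fun p => Z p.1 p.2
  have hα' : ∀ p, 0 ≤ α' p := fun p => hα p.1 p.2
  have hone : ∑ p, α' p = 1 := by
    have : (N : ℝ) ≠ 0 := Nat.cast_ne_zero.2 (NeZero.ne N)
    simp [α', Fintype.sum_prod_type, hsum, this]
  have hprob := isProbabilityMeasure_atomicMeasure Z' hα' hone
  refine le_iSup₂_of_le (atomicMeasure α' Z') ⟨hprob, ?_⟩ (le_iInf₂ ?_)
  · have hcoupling : (atomicMeasure α' fun p => (Zhat p.1, Z' p)).map Prod.fst = empirical Zhat ∧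
        (atomicMeasure α' fun p => (Zhat p.1, Z' p)).map Prod.snd = atomicMeasure α' Z' := by
      refine ⟨?_, map_atomicMeasure _ _ measurable_snd⟩
      rw [map_atomicMeasure _ _ measurable_fst]
      simp only [atomicMeasure, empirical, Fintype.sum_prod_type, ← Finset.sum_smul, α']
      rw [Finset.smul_sum]
      refine Finset.sum_congr rfl fun i _ => ?_
      rw [← ENNReal.ofReal_sum_of_nonneg fun j _ => hα i j, hsum, one_div,
        ENNReal.ofReal_inv_of_pos (Nat.cast_pos.2 (Nat.pos_of_neZero N)), ENNReal.ofReal_natCast]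
    refine iInf₂_le_of_le (atomicMeasure α' fun p => (Zhat p.1, Z' p)) hcoupling ?_
    rw [lintegral_atomicMeasure]
    · simp_rw [← ENNReal.ofReal_mul (hα' _)]
      rw [← ENNReal.ofReal_sum_of_nonneg fun p _ => mul_nonneg (hα' p) (apply_nonneg nrm _)]
      refine ENNReal.ofReal_le_ofReal ?_
      simp only [Fintype.sum_prod_type, α', Z']
      refine le_of_eq_of_le ?_ hdist
      simp only [map_sub_rev nrm]
    · exact (ENNReal.continuous_ofReal.comp (hnrm.comp
        ((continuous_subtype_val.comp continuous_fst).sub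
          (continuous_subtype_val.comp continuous_snd)))).measurable
  · rintro ℓ ⟨t, hℓ⟩
    obtain rfl : ℓ = _ := funext hℓ
    rw [EReal.coe_le_coe_iff,
      integral_atomicMeasure hα' _ (continuous_sup'_pairing obj c t).stronglyMeasurable]
    -- Adding this vanishing sum restores the t-terms, so each summand is one affine piece, below
    -- the maximum.
    have hzero : ∑ i, ∑ j, α i j * (c j * t) = 0 := by
      rw [Finset.sum_comm]
      have : ∀ j, ∑ i, α i j * (c j * t) = (∑ i, α i j) * c j * t := fun j => by
        rw [mul_assoc, Finset.sum_mul]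
      simp only [this, ← Finset.sum_mul, hc, zero_mul]
    rw [Fintype.sum_prod_type, ← add_zero (∑ i, ∑ j, _), ← hzero, ← Finset.sum_add_distrib]
    refine Finset.sum_le_sum fun i _ => ?_
    rw [← Finset.sum_add_distrib]
    refine Finset.sum_le_sum fun j _ => ?_
    rw [← mul_add]
    exact mul_le_mul_of_nonneg_left (Finset.le_sup'
      (fun k => pairing (obj k) (Z i j : GramPair K) + c k * t) (Finset.mem_univ j)) (hα i j)

/-- Kantorovich-type weak duality: a loss dominated by `λ ‖Z - Ẑ_i‖ + σ_i` for each `i` has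
expectation at most `λ ε + (1/N) ∑ σ_i` over the ambiguity set. -/
theorem integral_le_of_mem_ambiguitySet [NeZero N] (hS : IsCompact S)
    (nrm : Seminorm ℝ (GramPair K)) (hnrm : Continuous nrm) (Zhat : Fin N → S) {ε : ℝ}
    (hε : 0 ≤ ε) {Q : Measure S} (hQ : Q ∈ ambiguitySet nrm Zhat ε) {ℓ : S → ℝ}
    (hℓ : Continuous ℓ) {lam : ℝ} (hlam : 0 ≤ lam) {σ : Fin N → ℝ}
    (h : ∀ (i : Fin N) (Z : S),
      ℓ Z ≤ lam * nrm ((Z : GramPair K) - (Zhat i : GramPair K)) + σ i) :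
    ∫ Z, ℓ Z ∂Q ≤ lam * ε + 1 / (N : ℝ) * ∑ i, σ i := by
  have hcompact : CompactSpace S := isCompact_iff_compactSpace.1 hS
  obtain ⟨hprob, hW⟩ := hQ
  have hP := isProbabilityMeasure_empirical Zhat
  -- The lower envelope is a continuous potential on all of S with φ(Ẑ_i) ≤ σ_i. By the triangle
  -- inequality it still dominates the loss up to λ‖Y - Z‖, so no coupling has to be disintegrated
  -- over the atoms.
  let φ : S → ℝ := fun Y => Finset.univ.inf' Finset.univ_nonempty
    fun i => lam * nrm ((Y : GramPair K) - (Zhat i : GramPair K)) + σ i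
  have hφ : Continuous φ := Continuous.finset_inf'_apply _ fun i _ =>
    (continuous_const.mul (hnrm.comp (continuous_subtype_val.sub continuous_const))).add
      continuous_const
  have hcost : Continuous fun z : S × S => nrm ((z.1 : GramPair K) - (z.2 : GramPair K)) :=
    hnrm.comp ((continuous_subtype_val.comp continuous_fst).sub
      (continuous_subtype_val.comp continuous_snd))
  have hbound : ∀ Y Z : S, ℓ Z ≤ lam * nrm ((Y : GramPair K) - (Z : GramPair K)) + φ Y := by
    intro Y Z
    rw [← sub_le_iff_le_add']
    refine Finset.le_inf' _ _ fun i _ => ?_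
    have h1 := h i Z
    have h2 : nrm ((Z : GramPair K) - (Zhat i : GramPair K)) ≤
        nrm ((Y : GramPair K) - (Z : GramPair K)) +
          nrm ((Y : GramPair K) - (Zhat i : GramPair K)) := by
      rw [map_sub_rev nrm (Y : GramPair K) (Z : GramPair K)]
      refine le_trans (le_of_eq ?_) (map_add_le_add nrm _ _)
      rw [sub_add_sub_cancel]
    have h3 := mul_le_mul_of_nonneg_left h2 hlam
    linarith
  have hφP : ∫ Y, φ Y ∂(empirical Zhat) ≤ 1 / (N : ℝ) * ∑ i, σ i := by
    rw [integral_empirical Zhat hφ.stronglyMeasurable]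
    refine mul_le_mul_of_nonneg_left (Finset.sum_le_sum fun i _ => ?_) (by positivity)
    exact (Finset.inf'_le _ (Finset.mem_univ i)).trans_eq (by simp)
  refine le_of_forall_pos_le_add fun δ hδ => ?_
  -- The infimum over couplings is not assumed attained, hence the slack η; dividing by λ + 1 covers
  -- λ = 0.
  obtain ⟨η, hη, hηδ⟩ : ∃ η > 0, lam * η ≤ δ :=
    ⟨δ / (lam + 1), by positivity, by
      rw [mul_div_assoc', div_le_iff₀ (by positivity)]; nlinarith⟩
  have hlt : wasserstein nrm (empirical Zhat) Q < ENNReal.ofReal (ε + η) :=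
    hW.trans_lt ((ENNReal.ofReal_lt_ofReal_iff (by linarith)).2 (by linarith))
  simp only [wasserstein, iInf_lt_iff] at hlt
  obtain ⟨π, ⟨hπ1, hπ2⟩, hπ⟩ := hlt
  have hπprob : IsProbabilityMeasure π := by
    refine ⟨?_⟩
    have h1 : π.map Prod.fst Set.univ = 1 := by rw [hπ1]; exact measure_univ
    rwa [Measure.map_apply measurable_fst MeasurableSet.univ, Set.preimage_univ] at h1
  have hint : ∀ {f : S × S → ℝ}, Continuous f → Integrable f π := fun hf =>
    hf.integrable_of_hasCompactSupport (HasCompactSupport.of_compactSpace _)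
  have hcostle : ∫ z, nrm ((z.1 : GramPair K) - (z.2 : GramPair K)) ∂π ≤ ε + η := by
    rw [integral_eq_lintegral_of_nonneg_ae (Filter.Eventually.of_forall fun z => apply_nonneg nrm _)
      (hint hcost).aestronglyMeasurable]
    exact ENNReal.toReal_le_of_le_ofReal (by linarith) hπ.le
  have hQπ : ∫ Z, ℓ Z ∂Q = ∫ z, ℓ z.2 ∂π := by
    rw [← hπ2, integral_map measurable_snd.aemeasurable hℓ.stronglyMeasurable.aestronglyMeasurable]
  have hPπ : ∫ Y, φ Y ∂(empirical Zhat) = ∫ z, φ z.1 ∂π := by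
    rw [← hπ1, integral_map measurable_fst.aemeasurable hφ.stronglyMeasurable.aestronglyMeasurable]
  have hle : ∫ z, ℓ z.2 ∂π ≤
      ∫ z, (lam * nrm ((z.1 : GramPair K) - (z.2 : GramPair K)) + φ z.1) ∂π :=
    integral_mono (hint (hℓ.comp continuous_snd))
      (hint ((continuous_const.mul hcost).add (hφ.comp continuous_fst))) fun z => hbound z.1 z.2
  have hcost' : Integrable (fun z : S × S =>
      lam * nrm ((z.1 : GramPair K) - (z.2 : GramPair K))) π := hint (continuous_const.mul hcost)
  have hφ' : Integrable (fun z : S × S => φ z.1) π := hint (hφ.comp continuous_fst)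
  rw [integral_add hcost' hφ',
    integral_const_mul, ← hQπ, ← hPπ] at hle
  have := mul_le_mul_of_nonneg_left hcostle hlam
  linarith

theorem worstCaseExpectation_le_droPepValue [NeZero N] [NeZero J] {M : Type*} [Fintype M]
    (D : PEPData K M) (hcompact : IsCompact D.support) (nrm : Seminorm ℝ (GramPair K))
    (hnrm : ∀ Z, nrm Z = 0 → Z = 0) (Zhat : Fin N → D.support) (obj : Fin J → GramPair K)
    (c : Fin J → ℝ) {ε : ℝ} (hε : 0 ≤ ε) :
    worstCaseExpectation nrm Zhat ε obj c ≤ droPepValue D nrm Zhat ε obj c := by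
  refine iSup₂_le fun Q hQ => le_iInf₂ fun v hv => iInf₂_le_of_le _ ⟨v.t, fun Z => rfl⟩ ?_
  rw [EReal.coe_le_coe_iff]
  refine (integral_le_of_mem_ambiguitySet hcompact nrm (nrm.continuous_of_definite hnrm) Zhat hε hQ
    (continuous_sup'_pairing obj c v.t) hv.lam_nonneg
    (σ := fun i => v.s i - v.lam * ε) fun i Z => ?_).trans_eq ?_
  · refine Finset.sup'_le _ _ fun j _ => ?_
    obtain ⟨hpsd, hzero⟩ := hv.conic i j
    -- Pairing the conic slack with Z bounds ⟨obj j, Z⟩ by -⟨XY, Z⟩ + τ⟨init, Z⟩, because the y-term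
    -- has a favourable sign; the initial condition and the epigraph constraint then cancel the c₀τ
    -- terms.
    have h1 := pairing_nonneg_of_posSemidef hpsd hzero Z.2.1.1
    simp only [pairing_sub_left, pairing_add_left, pairing_neg_left, pairing_smul_left,
      D.pairing_opSAdj] at h1
    have h2 : 0 ≤ ∑ m, v.y i j m * D.opS Z m :=
      Finset.sum_nonneg fun m _ => mul_nonneg (hv.y_nonneg i j m) (Z.2.1.2 m)
    have h3 := mul_le_mul_of_nonneg_left Z.2.2.2 (hv.tau_nonneg i j)
    have h4 := hv.epigraph i j
    have h5 : -pairing (v.XY i j) ((Z : GramPair K) - (Zhat i : GramPair K)) ≤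
        v.lam * nrm ((Z : GramPair K) - (Zhat i : GramPair K)) := by
      rw [pairing_comm, ← pairing_neg_left, pairing_comm]
      refine (pairing_le_dualNorm_mul nrm hnrm _ _).trans ?_
      rw [map_neg_eq_map]
      exact mul_le_mul_of_nonneg_right (hv.dual_norm i j) (apply_nonneg nrm _)
    rw [pairing_sub_right] at h5
    linarith
  · have : (N : ℝ) ≠ 0 := Nat.cast_ne_zero.2 (NeZero.ne N)
    simp only [Finset.sum_sub_distrib, Finset.sum_const, Finset.card_univ, Fintype.card_fin,
      nsmul_eq_mul]
    field_simp
    ring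

end

theorem mainTheorem1 {K N J : ℕ} [NeZero N] [NeZero J] {M : Type*} [Fintype M]
    (D : PEPData K M) (hcompact : IsCompact D.support)
    (nrm : Seminorm ℝ (GramPair K)) (hnrm : ∀ Z, nrm Z = 0 → Z = 0)
    (Zhat : Fin N → D.support)
    (obj : Fin J → GramPair K) (c : Fin J → ℝ) (ε : ℝ) (hε : 0 < ε) :
    worstCaseExpectation nrm Zhat ε obj c = maximizationValue nrm Zhat ε obj c ∧
      worstCaseExpectation nrm Zhat ε obj c = droPepValue D nrm Zhat ε obj c := by
  have h1 := maximizationValue_le_worstCaseExpectation nrm (nrm.continuous_of_definite hnrm)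
    Zhat ε obj c
  have h2 := worstCaseExpectation_le_droPepValue D hcompact nrm hnrm Zhat obj c hε.le
  have h3 := droPepValue_le_maximizationValue D nrm ε c hcompact Zhat obj
  exact ⟨(h2.trans h3).antisymm h1, h2.antisymm (h3.trans h1)⟩
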